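/- Let $a_0,b_0,\alpha^*>0$ and let $B(n)>0$ be any factor depending only on the number $n$ of observations. For $1\le m\le n$ let the marked function be $$Q(m)=B(n)\,\frac{\Gamma(a_0+m)}{\Gamma(a_0)\,m!}\cdot\frac{b_0^{a_0}\,n^{m}}{(b_0+n)^{a_0+m}} .$$ In the DSDP mixture model with marked SGP prior (DSDP-MM), the random unordered partition $\mathcal M$ of $n$ observations into nonempty clusters has probability mass function proportional to $$\frac{(\alpha^*)^{K}\,\Gamma(\alpha^*)}{\Gamma(\alpha^*+n)}\prod_{k=1}^{K}\Gamma(n_k)\,Q(n_k)$$ at a partition with $K$ clusters of sizes $n_1,\dots,n_K$. Given $\mathcal M$, its clusters are put in an order chosen uniformly among the $|\mathcal M|!$ possible orders, and $\mathcal N=(\mathcal N_1,\dots,\mathcal N_{|\mathcal M|})$ is the resulting vector of cluster sizes. Theorem (conditional partition size probability of DSDP-MM). Let $K\ge 1$ and let $\mathbf n=(n_1,\dots,n_K)$ be positive integers with $n_1+\dots+n_K=n$. Then $$P\bigl(\mathcal N=\mathbf n \,\big|\, |\mathcal M|=K\bigr)\;\propto\;\prod_{k=1}^{K} n_k^{-1}\,\frac{\Gamma(a_0+n_k)}{\Gamma(a_0)\,\Gamma(n_k+1)},$$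 that is, the left-hand side equals the product on the right divided by the sum of the same product over all vectors of $K$ positive integers with sum $n$. This holds exactly for every $n$, and so in particular asymptotically as $n\to\infty$. -/

import Mathlib

open scoped ENNReal

namespace DSDP

noncomputable section

/-- The hyper-parameters of the model: the shape `a₀` and rate `b₀` of the mark, the concentration
`α` (written `α^*` in the text), and a factor `B n` of the marked function which depends on the
number `n` of observations only. All of them are positive reals. -/
structure Params where
  a₀ : ℝ
  b₀ : ℝ
  α : ℝ
  B : ℕ → ℝ
  a₀_pos : 0 < a₀
  b₀_pos : 0 < b₀
  α_pos : 0 < α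
  B_pos : ∀ n, 0 < B n

/-- The marked function `Q(m)` of a cluster of size `m` among `n` observations,
`B(n) · Γ(a₀ + m) / (Γ(a₀) m!) · b₀ ^ a₀ n ^ m / (b₀ + n) ^ (a₀ + m)`. -/
def Params.mark (θ : Params) (n m : ℕ) : ℝ :=
  θ.B n * (Real.Gamma (θ.a₀ + m) / (Real.Gamma θ.a₀ * (m.factorial : ℝ))) *
    (θ.b₀ ^ θ.a₀ * (n : ℝ) ^ m / (θ.b₀ + n) ^ (θ.a₀ + m))

/-- Unordered partitions of `n` observations into non-empty clusters. -/
abbrev Partn (n : ℕ) : Type := Finpartition (Finset.univ : Finset (Fin n))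

/-- The mass `α ^ K Γ(α) / Γ(α + n) · ∏ₖ Γ(nₖ) Q(nₖ)` of an unordered partition with `K` clusters
of sizes `n₁, …, n_K`. -/
def Params.mass (θ : Params) {n : ℕ} (M : Partn n) : ℝ :=
  θ.α ^ M.parts.card * Real.Gamma θ.α / Real.Gamma (θ.α + n) *
    ∏ A ∈ M.parts, (Real.Gamma (A.card : ℝ) * θ.mark n A.card)

theorem Params.mass_pos (θ : Params) {n : ℕ} (M : Partn n) : 0 < θ.mass M := by
  have ha := θ.a₀_pos
  have hb := θ.b₀_pos
  have hα := θ.α_pos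
  have hB := θ.B_pos n
  unfold Params.mass
  refine mul_pos (div_pos (mul_pos (pow_pos hα _) (Real.Gamma_pos_of_pos hα))
    (Real.Gamma_pos_of_pos (by positivity))) (Finset.prod_pos fun A hA => ?_)
  have hA' : 0 < A.card := (M.nonempty_of_mem_parts hA).card_pos
  have hn : 0 < n := by
    have h := Finset.card_le_univ A
    rw [Fintype.card_fin] at h
    omega
  have hA'' : (0 : ℝ) < A.card := by exact_mod_cast hA'
  have hn' : (0 : ℝ) < n := by exact_mod_cast hn
  have h1 := Real.Gamma_pos_of_pos hA''
  have h2 := Real.Gamma_pos_of_pos ha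
  have h3 : 0 < Real.Gamma (θ.a₀ + A.card) := Real.Gamma_pos_of_pos (by positivity)
  unfold Params.mark
  positivity

theorem Params.tsum_mass_ne_zero (θ : Params) (n : ℕ) :
    (∑' M : Partn n, ENNReal.ofReal (θ.mass M)) ≠ 0 := fun h =>
  (ENNReal.ofReal_pos.2 (θ.mass_pos (⊥ : Partn n))).ne' (ENNReal.tsum_eq_zero.1 h ⊥)

theorem Params.tsum_mass_ne_top (θ : Params) (n : ℕ) :
    (∑' M : Partn n, ENNReal.ofReal (θ.mass M)) ≠ ∞ := by
  rw [tsum_fintype]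
  exact ENNReal.sum_ne_top.2 fun _ _ => ENNReal.ofReal_ne_top

/-- The law of the random unordered partition: the probability of `M` is proportional to its mass
(and equal to it whenever `B n` is chosen so that the masses add up to one). -/
def Params.partitionLaw (θ : Params) (n : ℕ) : PMF (Partn n) :=
  PMF.normalize (fun M => ENNReal.ofReal (θ.mass M)) (θ.tsum_mass_ne_zero n) (θ.tsum_mass_ne_top n)

/-- The orderings (enumerations) of the clusters of a partition. -/
abbrev Ordering {n : ℕ} (M : Partn n) : Type := Fin M.parts.card ≃ M.parts

instance instNonemptyOrdering {n : ℕ} (M : Partn n) : Nonempty (Ordering M) :=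
  ⟨M.parts.equivFin.symm⟩

/-- Ordered partitions: a partition together with an ordering of its clusters. -/
def OrderedPartn (n : ℕ) : Type := Σ M : Partn n, Ordering M

instance instMeasurableSpaceOrderedPartn (n : ℕ) : MeasurableSpace (OrderedPartn n) := ⊤

/-- The law of the random ordered partition: draw the unordered partition `M`, then one of its
`|M|!` orderings uniformly. -/
def Params.orderedLaw (θ : Params) (n : ℕ) : PMF (OrderedPartn n) :=
  (θ.partitionLaw n).bind fun M =>
    (PMF.uniformOfFintype (Ordering M)).map fun e => (⟨M, e⟩ : OrderedPartn n)

/-- The number `|M|` of clusters. -/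
def OrderedPartn.numClusters {n : ℕ} (x : OrderedPartn n) : ℕ := x.1.parts.card

/-- The size vector `N = (N₁, …, N_{|M|})` of an ordered partition; a list, because its length is
random. -/
def OrderedPartn.sizes {n : ℕ} (x : OrderedPartn n) : List ℕ :=
  List.ofFn fun i : Fin x.1.parts.card => (x.2 i : Finset (Fin n)).card

/-- `P(N = v | |M| = K)` for `n` observations. -/
def Params.condSizeProb (θ : Params) (n K : ℕ) (v : Fin K → ℕ) : ℝ :=
  (ProbabilityTheory.cond (θ.orderedLaw n).toMeasure {x | x.numClusters = K}).real
    {x | x.sizes = List.ofFn v}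

/-- The vectors of `K` positive integers with sum `n`. -/
def sizeVectors (K n : ℕ) : Finset (Fin K → ℕ) :=
  (Finset.piAntidiag Finset.univ n).filter fun v => ∀ k, 0 < v k

/-- `∏ₖ nₖ⁻¹ Γ(a₀ + nₖ) / (Γ(a₀) Γ(nₖ + 1))`. -/
def sizeWeight (a₀ : ℝ) {K : ℕ} (v : Fin K → ℕ) : ℝ :=
  ∏ k, ((v k : ℝ)⁻¹ * (Real.Gamma (a₀ + v k) / (Real.Gamma a₀ * Real.Gamma (v k + 1))))

end

end DSDP

/-!
The law of the size vector is computed up to a factor depending on `n` and `K` only.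

An ordered partition of `n` observations with `K` clusters is the same as a surjective labelling of
the observations by `Fin K` (`OrderedPartn.label_eq_iff`, `OrderedPartn.exists_label_eq`). The
labellings with fibre sizes `u` form one orbit of the permutations of the observations, with
stabilizers of order `∏ uₖ!` (`card_labellings_mul_prod_factorial`), so exactly `n! / ∏ uₖ!` ordered
partitions have size vector `u` (`card_sizes_eq_mul_prod_factorial`).

All of these have the same probability: the mass of the underlying partition, divided by the total
mass and by the number `K!` of orderings. Because `∑ uₖ = n`, the powers in the marked function
collect into a factor of `n` and `K`, and as `Γ(m) = m! / m` the mass is that factor times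
`sizeWeight a₀ u * ∏ uₖ!` (`Params.mass_eq`). The factorials cancel against the count, hence
`P(N = u)` is proportional to `sizeWeight a₀ u` (`Params.measureReal_sizes_eq`). The event
`|M| = K` is the disjoint union of the events `N = u` over `u ∈ sizeVectors K n`
(`Params.measureReal_numClusters_eq`), and the constant drops out of the conditional probability.
-/

open scoped Nat

namespace DSDP

/-! ### Counting labellings with prescribed fibre sizes -/

section Labellings

variable {α ι : Type*} [Fintype α] [DecidableEq ι]

theorem exists_perm_comp_eq_of_card_fiber_eq (f g : α → ι)
    (h : ∀ i, Fintype.card {a // f a = i} = Fintype.card {a // g a = i}) :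
    ∃ σ : Equiv.Perm α, f ∘ σ = g := by
  have e : ∀ i, {a // g a = i} ≃ {a // f a = i} := fun i => Fintype.equivOfCardEq (h i).symm
  -- Glue the bijections between corresponding fibres.
  refine ⟨(Equiv.sigmaFiberEquiv g).symm.trans
    ((Equiv.sigmaCongrRight e).trans (Equiv.sigmaFiberEquiv f)), ?_⟩
  funext a
  exact (e (g a) ⟨a, rfl⟩).2

theorem exists_card_fiber_eq [Fintype ι] (v : ι → ℕ) (hv : ∑ i, v i = Fintype.card α) :
    ∃ f : α → ι, ∀ i, Fintype.card {a // f a = i} = v i := by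
  have hc : Fintype.card α = Fintype.card (Σ i, Fin (v i)) := by simp [hv]
  obtain ⟨e⟩ := Fintype.card_eq.1 hc
  refine ⟨fun a => (e a).1, fun i => ?_⟩
  have e₁ : {a // (e a).1 = i} ≃ {s : Σ i, Fin (v i) // s.1 = i} :=
    e.subtypeEquiv fun _ => Iff.rfl
  rw [Fintype.card_congr (e₁.trans (Equiv.sigmaSubtype i)), Fintype.card_fin]

/-- The labellings with fibre sizes `v` form a single orbit under permutations of the domain, and
the stabilizer of a labelling is the product of the symmetric groups of its fibres. -/
theorem card_labellings_mul_prod_factorial [Fintype ι] (v : ι → ℕ)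
    (hv : ∑ i, v i = Fintype.card α) :
    Nat.card {f : α → ι // ∀ i, Fintype.card {a // f a = i} = v i} * ∏ i, (v i)! =
      (Fintype.card α)! := by
  classical
  obtain ⟨f, hf⟩ := exists_card_fiber_eq v hv
  let T : Finset (α → ι) := Finset.univ.filter fun g => ∀ i, Fintype.card {a // g a = i} = v i
  have hmaps : ∀ σ ∈ (Finset.univ : Finset (Equiv.Perm α)), f ∘ σ ∈ T := by
    intro σ _
    refine Finset.mem_filter.2 ⟨Finset.mem_univ _, fun i => ?_⟩
    rw [← hf i]
    exact Fintype.card_congr (σ.subtypeEquiv fun _ => Iff.rfl)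
  -- The permutations carrying `f` to `f ∘ τ` form the coset of `τ` under the stabilizer of `f`.
  have hfib : ∀ g ∈ T,
      (Finset.univ.filter fun σ : Equiv.Perm α => f ∘ σ = g).card = ∏ i, (v i)! := by
    intro g hg
    obtain ⟨τ, rfl⟩ := exists_perm_comp_eq_of_card_fiber_eq f g fun i => by
      rw [hf i, (Finset.mem_filter.1 hg).2 i]
    have hst := DomMulAct.stabilizer_card f
    simp only [hf] at hst
    rw [← hst, Fintype.card_subtype]
    refine Finset.card_equiv (Equiv.mulRight τ⁻¹) fun σ => ?_
    simp only [Finset.mem_filter, Finset.mem_univ, true_and, Equiv.coe_mulRight,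
      Equiv.Perm.coe_mul, ← Function.comp_assoc]
    constructor
    · intro h
      rw [h, Function.comp_assoc, ← Equiv.Perm.coe_mul, mul_inv_cancel]
      rfl
    · intro h
      conv_rhs => rw [← h]
      rw [Function.comp_assoc, ← Equiv.Perm.coe_mul, inv_mul_cancel]
      rfl
  have hcount := Finset.card_eq_sum_card_fiberwise hmaps
  rw [Finset.sum_congr rfl hfib, Finset.sum_const, Finset.card_univ, Fintype.card_perm,
    smul_eq_mul] at hcount
  rw [hcount, Nat.card_eq_fintype_card, Fintype.card_subtype]

end Labellings

/-! ### Ordered partitions as labellings -/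

noncomputable instance instFintypeOrderedPartn (n : ℕ) : Fintype (OrderedPartn n) :=
  inferInstanceAs (Fintype (Σ M : Partn n, Ordering M))

instance instDiscreteMeasurableSpaceOrderedPartn (n : ℕ) :
    DiscreteMeasurableSpace (OrderedPartn n) :=
  ⟨fun _ => trivial⟩

/-- The `i`-th cluster of an ordered partition with `K` clusters. -/
def OrderedPartn.block {n K : ℕ} (x : OrderedPartn n) (h : x.numClusters = K) (i : Fin K) :
    Finset (Fin n) :=
  x.2 (Fin.cast h.symm i)

/-- The labelling of the observations by the indices of their clusters. -/
def OrderedPartn.label {n K : ℕ} (x : OrderedPartn n) (h : x.numClusters = K) (a : Fin n) :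
    Fin K :=
  Fin.cast h (x.2.symm ⟨x.1.part a, x.1.part_mem.2 (Finset.mem_univ a)⟩)

theorem OrderedPartn.label_eq_iff {n K : ℕ} (x : OrderedPartn n) (h : x.numClusters = K)
    (a : Fin n) (i : Fin K) : x.label h a = i ↔ a ∈ x.block h i := by
  subst h
  change x.2.symm _ = i ↔ a ∈ (x.2 i : Finset (Fin n))
  exact (Equiv.symm_apply_eq _).trans
    (Subtype.ext_iff.trans (x.1.part_eq_iff_mem (x.2 i).2))

theorem OrderedPartn.card_label_fiber {n K : ℕ} (x : OrderedPartn n) (h : x.numClusters = K)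
    (i : Fin K) : Fintype.card {a // x.label h a = i} = (x.block h i).card := by
  simp only [x.label_eq_iff h, Fintype.card_coe]

theorem OrderedPartn.sizes_eq_ofFn_iff {n K : ℕ} (x : OrderedPartn n) (u : Fin K → ℕ) :
    x.sizes = List.ofFn u ↔ ∃ h : x.numClusters = K, ∀ i, (x.block h i).card = u i := by
  constructor
  · intro hx
    have h : x.numClusters = K := by
      simpa [OrderedPartn.sizes, OrderedPartn.numClusters] using congrArg List.length hx
    refine ⟨h, ?_⟩
    subst h
    exact fun i => congrFun (List.ofFn_injective hx) i
  · rintro ⟨h, hx⟩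
    subst h
    exact congrArg List.ofFn (funext hx)

/-- The clusters, listed in their order, determine the ordered partition. -/
theorem OrderedPartn.ext_block {n K : ℕ} {x y : OrderedPartn n} (hx : x.numClusters = K)
    (hy : y.numClusters = K) (h : ∀ i, x.block hx i = y.block hy i) : x = y := by
  have aux : ∀ {x y : OrderedPartn n} (hx : x.numClusters = K) (hy : y.numClusters = K),
      (∀ i, x.block hx i = y.block hy i) → x.1.parts ⊆ y.1.parts := by
    intro x y hx hy h A hA
    subst hx
    have hAx : x.block rfl (x.2.symm ⟨A, hA⟩) = A :=
      congrArg Subtype.val (x.2.apply_symm_apply ⟨A, hA⟩)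
    exact hAx ▸ (h (x.2.symm ⟨A, hA⟩)).symm ▸ (y.2 _).2
  have hM : x.1 = y.1 := Finpartition.ext
    ((aux hx hy h).antisymm (aux hy hx fun i => (h i).symm))
  obtain ⟨M, e⟩ := x
  obtain ⟨M', e'⟩ := y
  obtain rfl : M = M' := hM
  subst hx
  have he : e = e' := Equiv.ext fun i => Subtype.ext (h i)
  rw [he]

/-- Every surjective labelling comes from an ordered partition. -/
theorem OrderedPartn.exists_label_eq {n K : ℕ} (f : Fin n → Fin K)
    (hf : Function.Surjective f) :
    ∃ (x : OrderedPartn n) (h : x.numClusters = K), x.label h = f := by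
  let b : Fin K → Finset (Fin n) := fun i => Finset.univ.filter fun a => f a = i
  have hmem : ∀ a i, a ∈ b i ↔ f a = i := fun a i => by simp [b]
  have hne : ∀ i, (b i).Nonempty := fun i => (hf i).imp fun a ha => (hmem a i).2 ha
  have hinj : Function.Injective b := by
    intro i j hij
    obtain ⟨a, ha⟩ := hf i
    have : a ∈ b j := hij ▸ (hmem a i).2 ha
    rw [← ha, (hmem a j).1 this]
  let M : Partn n := Finpartition.ofExistsUnique (Finset.univ.image b)
    (fun _ _ => Finset.subset_univ _)
    (fun a _ => ⟨b (f a), ⟨Finset.mem_image_of_mem _ (Finset.mem_univ _), (hmem a _).2 rfl⟩, by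
      rintro B ⟨hB, haB⟩
      obtain ⟨i, -, rfl⟩ := Finset.mem_image.1 hB
      rw [(hmem a i).1 haB]⟩)
    (fun h => by
      obtain ⟨i, -, hi⟩ := Finset.mem_image.1 h
      exact (hne i).ne_empty hi)
  have hparts : M.parts = Finset.univ.image b := rfl
  have hcard : M.parts.card = K := by
    rw [hparts, Finset.card_image_of_injective _ hinj, Finset.card_univ, Fintype.card_fin]
  let c : Fin K → M.parts := fun i => ⟨b i, Finset.mem_image_of_mem _ (Finset.mem_univ _)⟩
  have hc : Function.Bijective c := by
    refine ⟨fun i j hij => hinj (congrArg Subtype.val hij), fun B => ?_⟩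
    obtain ⟨i, -, hi⟩ := Finset.mem_image.1 B.2
    exact ⟨i, Subtype.ext hi⟩
  let x : OrderedPartn n := ⟨M, (finCongr hcard).trans (Equiv.ofBijective c hc)⟩
  refine ⟨x, hcard, funext fun a => (x.label_eq_iff hcard a (f a)).2 ?_⟩
  exact (hmem a (f a)).2 rfl

/-- There are `n! / ∏ uₖ!` ordered partitions with size vector `u`: they correspond to the labellings
with fibre sizes `u`, which are surjective as all the `uₖ` are positive. -/
theorem card_sizes_eq_mul_prod_factorial {n K : ℕ} (u : Fin K → ℕ) (hu : u ∈ sizeVectors K n) :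
    (Finset.univ.filter fun x : OrderedPartn n => x.sizes = List.ofFn u).card * ∏ i, (u i)! =
      n ! := by
  obtain ⟨hsum, hpos⟩ : ∑ i, u i = n ∧ ∀ i, 0 < u i := by simpa [sizeVectors] using hu
  have key := card_labellings_mul_prod_factorial (α := Fin n) u (by rw [hsum, Fintype.card_fin])
  rw [Fintype.card_fin] at key
  rw [← key, ← Fintype.card_subtype, ← Nat.card_eq_fintype_card]
  congr 1
  have hx : ∀ x : {x : OrderedPartn n // x.sizes = List.ofFn u}, x.1.numClusters = K := fun x =>
    ((x.1.sizes_eq_ofFn_iff u).1 x.2).1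
  refine Nat.card_eq_of_bijective (f := fun x => ⟨x.1.label (hx x), fun i => ?_⟩) ⟨?_, ?_⟩
  · rw [x.1.card_label_fiber]
    exact ((x.1.sizes_eq_ofFn_iff u).1 x.2).2 i
  · intro x y hxy
    have hl : x.1.label (hx x) = y.1.label (hx y) := congrArg Subtype.val hxy
    refine Subtype.ext (OrderedPartn.ext_block (hx x) (hx y) fun i => Finset.ext fun a => ?_)
    rw [← OrderedPartn.label_eq_iff, hl, OrderedPartn.label_eq_iff]
  · rintro ⟨f, hf⟩
    obtain ⟨x, h, rfl⟩ := OrderedPartn.exists_label_eq f fun i => by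
      have : 0 < Fintype.card {a // f a = i} := by rw [hf i]; exact hpos i
      obtain ⟨a, ha⟩ := Fintype.card_pos_iff.1 this
      exact ⟨a, ha⟩
    exact ⟨⟨x, (x.sizes_eq_ofFn_iff u).2
      ⟨h, fun i => by rw [← x.card_label_fiber h, hf i]⟩⟩, rfl⟩

theorem OrderedPartn.prod_block {n K : ℕ} (x : OrderedPartn n) (h : x.numClusters = K)
    (F : ℕ → ℝ) : ∏ A ∈ x.1.parts, F A.card = ∏ i, F (x.block h i).card := by
  subst h
  rw [← Finset.prod_coe_sort]
  exact (x.2.prod_comp fun A => F (A : Finset (Fin n)).card).symm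

theorem OrderedPartn.card_block_mem_sizeVectors {n K : ℕ} (x : OrderedPartn n)
    (h : x.numClusters = K) : (fun i => (x.block h i).card) ∈ sizeVectors K n := by
  subst h
  have hsum : ∑ i, (x.block rfl i).card = n := by
    have := x.1.sum_card_parts
    rw [← Finset.sum_coe_sort, Finset.card_univ, Fintype.card_fin] at this
    exact (x.2.sum_comp fun A => (A : Finset (Fin n)).card).trans this
  have hpos : ∀ i, 0 < (x.block rfl i).card := fun i =>
    (x.1.nonempty_of_mem_parts (x.2 i).2).card_pos
  simpa [sizeVectors, hsum] using fun i => Finset.card_pos.1 (hpos i)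

/-! ### The law of the size vector -/

/-- Since the sizes add up to `n`, the factors `B n`, `b₀ ^ a₀ n ^ m` and `(b₀ + n) ^ (a₀ + m)` of
the marked function contribute to the mass through `K` and `n` only; this is the resulting factor,
apart from the normalization of the law. -/
noncomputable def Params.massFactor (θ : Params) (n K : ℕ) : ℝ :=
  θ.α ^ K * Real.Gamma θ.α / Real.Gamma (θ.α + n) *
    ((θ.B n * (θ.b₀ ^ θ.a₀ / (θ.b₀ + n) ^ θ.a₀)) ^ K * ((n : ℝ) / (θ.b₀ + n)) ^ n)

theorem Params.massFactor_pos (θ : Params) (n K : ℕ) : 0 < θ.massFactor n K := by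
  have hb := θ.b₀_pos
  have hα := θ.α_pos
  have hB := θ.B_pos n
  have h1 := Real.Gamma_pos_of_pos hα
  have h2 : 0 < Real.Gamma (θ.α + n) := Real.Gamma_pos_of_pos (by positivity)
  have h3 : 0 < ((n : ℝ) / (θ.b₀ + n)) ^ n := by
    rcases n.eq_zero_or_pos with rfl | hn
    · -- Without observations the factor is `0 ^ 0 = 1`.
      simp
    · have : (0 : ℝ) < n := by exact_mod_cast hn
      positivity
  unfold Params.massFactor
  positivity

/-- The contribution of one cluster to the mass, with the weight of its size and the factor `m!`
split off. -/
theorem Params.gamma_mul_mark (θ : Params) (n : ℕ) {m : ℕ} (hm : 0 < m) :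
    Real.Gamma m * θ.mark n m =
      θ.B n * (θ.b₀ ^ θ.a₀ / (θ.b₀ + n) ^ θ.a₀) * ((n : ℝ) / (θ.b₀ + n)) ^ m *
        (((m : ℝ)⁻¹ * (Real.Gamma (θ.a₀ + m) / (Real.Gamma θ.a₀ * Real.Gamma (m + 1)))) * m !) := by
  have hb : 0 < θ.b₀ + n := add_pos_of_pos_of_nonneg θ.b₀_pos (Nat.cast_nonneg n)
  have hm' : (m : ℝ) ≠ 0 := by exact_mod_cast hm.ne'
  have hG : Real.Gamma m = (m : ℝ)⁻¹ * m ! := by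
    rw [← Real.Gamma_nat_eq_factorial, Real.Gamma_add_one hm', inv_mul_cancel_left₀ hm']
  have hpow : (θ.b₀ + n : ℝ) ^ (θ.a₀ + (m : ℝ)) = (θ.b₀ + n) ^ θ.a₀ * (θ.b₀ + n) ^ m := by
    rw [Real.rpow_add hb, Real.rpow_natCast]
  rw [Params.mark, hG, hpow, Real.Gamma_nat_eq_factorial, div_pow]
  simp only [div_eq_mul_inv, mul_inv]
  ring

theorem Params.mass_eq (θ : Params) {n K : ℕ} (x : OrderedPartn n) (u : Fin K → ℕ)
    (hx : x.sizes = List.ofFn u) :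
    θ.mass x.1 = θ.massFactor n K * (sizeWeight θ.a₀ u * ∏ i, ((u i)! : ℝ)) := by
  obtain ⟨h, hu⟩ := (x.sizes_eq_ofFn_iff u).1 hx
  obtain ⟨hsum, hpos⟩ : ∑ i, u i = n ∧ ∀ i, 0 < u i := by
    have := x.card_block_mem_sizeVectors h
    simp only [hu] at this
    simpa [sizeVectors] using this
  have hK : x.1.parts.card = K := h
  rw [Params.mass, hK, x.prod_block h fun m => Real.Gamma m * θ.mark n m, Params.massFactor,
    mul_assoc]
  congr 1
  rw [Finset.prod_congr rfl fun i _ => by rw [hu i, θ.gamma_mul_mark n (hpos i)]]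
  simp only [Finset.prod_mul_distrib, Finset.prod_const, Finset.prod_pow_eq_pow_sum, hsum,
    Finset.card_univ, Fintype.card_fin, sizeWeight, mul_pow]

theorem Params.orderedLaw_apply (θ : Params) {n : ℕ} (x : OrderedPartn n) :
    θ.orderedLaw n x = ENNReal.ofReal (θ.mass x.1) *
      (∑' M : Partn n, ENNReal.ofReal (θ.mass M))⁻¹ * ((x.1.parts.card)! : ℝ≥0∞)⁻¹ := by
  classical
  obtain ⟨M, e⟩ := x
  have hcard : Fintype.card (Ordering M) = (M.parts.card)! := by
    rw [Fintype.card_equiv (M.parts.equivFin.symm), Fintype.card_fin]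
  refine (PMF.bind_apply _ _ _).trans ?_
  rw [tsum_eq_single M]
  · have hmap : (PMF.uniformOfFintype (Ordering M)).map
        (fun e => (⟨M, e⟩ : OrderedPartn n)) ⟨M, e⟩ = ((M.parts.card)! : ℝ≥0∞)⁻¹ := by
      refine (PMF.map_apply _ _ _).trans
        ((tsum_eq_single e fun e' he => if_neg fun h => ?_).trans ?_)
      · exact he (eq_of_heq (Sigma.mk.inj h).2).symm
      · simp [hcard]
    exact congrArg₂ (· * ·) (PMF.normalize_apply _ _ M) hmap
  · intro M' hM
    have hmap : (PMF.uniformOfFintype (Ordering M')).map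
        (fun e => (⟨M', e⟩ : OrderedPartn n)) ⟨M, e⟩ = 0 :=
      (PMF.map_apply _ _ _).trans <| ENNReal.tsum_eq_zero.2 fun e' => if_neg fun h =>
        hM (Sigma.mk.inj h).1.symm
    exact mul_eq_zero_of_right _ hmap

/-- Each of the `n! / ∏ uₖ!` ordered partitions with size vector `u` has the same probability, and
the factorials cancel against those in the mass. -/
theorem Params.measureReal_sizes_eq (θ : Params) (n K : ℕ) :
    ∃ c : ℝ, 0 < c ∧ ∀ u ∈ sizeVectors K n,
      (θ.orderedLaw n).toMeasure.real {x | x.sizes = List.ofFn u} = c * sizeWeight θ.a₀ u := by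
  have hZ₀ := θ.tsum_mass_ne_zero n
  have hZ₁ := θ.tsum_mass_ne_top n
  set Z := ∑' M : Partn n, ENNReal.ofReal (θ.mass M) with hZ
  have hZpos : 0 < Z.toReal := ENNReal.toReal_pos hZ₀ hZ₁
  have hfac := θ.massFactor_pos n K
  refine ⟨θ.massFactor n K * (Z.toReal)⁻¹ * ((K ! : ℕ) : ℝ)⁻¹ * (n ! : ℕ), by positivity,
    fun u hu => ?_⟩
  have hset : {x : OrderedPartn n | x.sizes = List.ofFn u} =
      (Finset.univ.filter fun x : OrderedPartn n => x.sizes = List.ofFn u : Finset _) := by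
    ext x; simp
  rw [MeasureTheory.measureReal_def, hset, PMF.toMeasure_apply_finset,
    ENNReal.toReal_sum fun x _ => (θ.orderedLaw n).apply_ne_top x,
    Finset.sum_congr rfl (g := fun _ => θ.massFactor n K *
      (sizeWeight θ.a₀ u * ∏ i, ((u i)! : ℝ)) * (Z.toReal)⁻¹ * ((K ! : ℕ) : ℝ)⁻¹)]
  · have key := card_sizes_eq_mul_prod_factorial u hu
    rw [Finset.sum_const, nsmul_eq_mul, ← key]
    push_cast
    ring
  · intro x hx
    have hx' := (Finset.mem_filter.1 hx).2
    have hK : x.1.parts.card = K := ((x.sizes_eq_ofFn_iff u).1 hx').1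
    rw [θ.orderedLaw_apply, ← hZ, ENNReal.toReal_mul, ENNReal.toReal_mul,
      ENNReal.toReal_ofReal (θ.mass_pos _).le, θ.mass_eq x u hx', ENNReal.toReal_inv,
      ENNReal.toReal_inv, ENNReal.toReal_natCast, hK]

theorem Params.measureReal_numClusters_eq (θ : Params) (n K : ℕ) :
    (θ.orderedLaw n).toMeasure.real {x | x.numClusters = K} =
      ∑ u ∈ sizeVectors K n, (θ.orderedLaw n).toMeasure.real {x | x.sizes = List.ofFn u} := by
  have hset : {x : OrderedPartn n | x.numClusters = K} =
      ⋃ u ∈ sizeVectors K n, {x | x.sizes = List.ofFn u} := by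
    ext x
    simp only [Set.mem_ofPred_eq, Set.mem_iUnion, exists_prop]
    constructor
    · exact fun h => ⟨_, x.card_block_mem_sizeVectors h,
        (x.sizes_eq_ofFn_iff _).2 ⟨h, fun _ => rfl⟩⟩
    · rintro ⟨u, -, hx⟩
      exact ((x.sizes_eq_ofFn_iff u).1 hx).1
  rw [hset, MeasureTheory.measureReal_biUnion_finset]
  · intro u _ w _ huw
    refine Set.disjoint_left.2 fun x hu hw => huw (List.ofFn_injective ?_)
    exact (Eq.symm hu).trans hw
  · exact fun _ _ => MeasurableSet.of_discrete

end DSDP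

theorem mainTheorem2 (θ : DSDP.Params) (K : ℕ) (hK : 1 ≤ K) (v : Fin K → ℕ) (hv : ∀ k, 0 < v k)
    (n : ℕ) (hn : ∑ k, v k = n) :
    θ.condSizeProb n K v =
      DSDP.sizeWeight θ.a₀ v / ∑ u ∈ DSDP.sizeVectors K n, DSDP.sizeWeight θ.a₀ u := by
  have hmem : v ∈ DSDP.sizeVectors K n := by simp [DSDP.sizeVectors, hn, hv]
  obtain ⟨c, hc, hlaw⟩ := θ.measureReal_sizes_eq n K
  have hsub : {x : DSDP.OrderedPartn n | x.numClusters = K} ∩ {x | x.sizes = List.ofFn v} =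
      {x | x.sizes = List.ofFn v} :=
    Set.inter_eq_right.2 fun x hx => ((x.sizes_eq_ofFn_iff v).1 hx).1
  rw [DSDP.Params.condSizeProb, MeasureTheory.measureReal_def,
    ProbabilityTheory.cond_apply MeasurableSet.of_discrete, hsub, ENNReal.toReal_mul,
    ENNReal.toReal_inv, ← MeasureTheory.measureReal_def, ← MeasureTheory.measureReal_def,
    θ.measureReal_numClusters_eq, Finset.sum_congr rfl hlaw, hlaw v hmem, ← Finset.mul_sum,
    inv_mul_eq_div, mul_div_mul_left _ _ hc.ne']
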